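/- Let $-\infty\le a<b\le\infty$, let $V\in L^1_{\mathrm{loc}}(a,b)$ be real-valued, let $I\subseteq\mathbb Z$, and let $M=\{x_n\}_{n\in I}\subset(a,b)$ consist of distinct points with no accumulation point in $(a,b)$. For $\alpha,\theta\in\mathbb R$ and $r>0$ put $$A_{\alpha,r,\theta}=\begin{pmatrix}1&\alpha\\0&1\end{pmatrix}\begin{pmatrix}r&0\\0&1/r\end{pmatrix}\begin{pmatrix}\cos\theta&-\sin\theta\\ \sin\theta&\cos\theta\end{pmatrix}.$$ Fix $\Lambda=(\alpha_n)_{n\in I}\in\mathbb R^I$ and $R=(r_n)_{n\in I}\in(0,\infty)^I$. For $\Theta=(\theta_n)_{n\in I}\in\mathbb R^I$ and $z\in\mathbb C$, a solution of $(\tau_\Theta-z)f=0$ is a function $f$ such that $f,f'$ are locally absolutely continuous in $(a,b)\setminus M$, $-f''+Vf=zf$ almost everywhere, and $$\begin{pmatrix}f(x_n+)\\f'(x_n+)\end{pmatrix}=A_{\alpha_n,r_n,\theta_n}\begin{pmatrix}f(x_n-)\\f'(x_n-)\end{pmatrix}\qquad(n\in I).\tag{1}$$ Call $\tau_\Theta$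 limit point at $a$ (at $b$) if for every $z\in\mathbb C$ some solution of $(\tau_\Theta-z)f=0$ is not square integrable near $a$ (near $b$). Call it regular at $a$ if $a$ is finite, $V\in L^1_{\mathrm{loc}}[a,b)$ and $a$ is not an accumulation point of $M$; similarly at $b$ (with $L^1_{\mathrm{loc}}(a,b]$). Assume that, for every $\Theta\in\mathbb R^I$, $\tau_\Theta$ is limit point or regular at $a$, and limit point or regular at $b$. Fix $\psi_a,\psi_b\in\mathbb R$ and let $H_\Theta$ be the operator $H_\Theta f=-f''+Vf$ in $L^2(a,b)$ whose domain consists of all $f\in L^2(a,b)$ such that $f,f'$ are locally absolutely continuous in $(a,b)\setminus M$, $-f''+Vf\in L^2(a,b)$, (1) holds, and $f(a)\cos\psi_a+f'(a)\sin\psi_a=0$ if $a$ is regular, $f(b)\cos\psi_b+f'(b)\sin\psi_b=0$ if $b$ is regular. Let $\sigma_p(H_\Theta)$ be its set of eigenvalues. Let $(q_n)_{n\in I}$ be Borel probability measures on $\mathbb R$ and let $\mathbb P_3=\times_{n\in I}q_n$ be the product measure on $\mathbb R^I$. Assume that $q_{n_0}$ is continuous (i.e. $q_{n_0}(\{t\})=0$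 for every $t\in\mathbb R$) for at least one $n_0\in I$. Then for every $E\in\mathbb R$ and every subset $B$ of $\{\Theta\in\mathbb R^I: E\in\sigma_p(H_\Theta)\}$ that is measurable with respect to the product $\sigma$-algebra, or more generally with respect to its $\mathbb P_3$-completion, $\mathbb P_3(B)=0$. -/

import Mathlib

open MeasureTheory Set Filter Topology

noncomputable section

/-- `P_α = [[1, α], [0, 1]]`. -/
def parabolicMatrix (α : ℝ) : Matrix (Fin 2) (Fin 2) ℝ := !![1, α; 0, 1]

/-- `H_r = [[r, 0], [0, 1/r]]` (used for `r > 0`). -/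
def hyperbolicMatrix (r : ℝ) : Matrix (Fin 2) (Fin 2) ℝ := !![r, 0; 0, 1 / r]

/-- `E_θ`, the rotation by the angle `θ`. -/
def ellipticMatrix (θ : ℝ) : Matrix (Fin 2) (Fin 2) ℝ :=
  !![Real.cos θ, -Real.sin θ; Real.sin θ, Real.cos θ]

/-- The matrix with Iwasawa decomposition `P_α H_r E_θ`. -/
def interactionMatrix (α r θ : ℝ) : Matrix (Fin 2) (Fin 2) ℝ :=
  parabolicMatrix α * hyperbolicMatrix r * ellipticMatrix θ

/-- The differential expression `τ f = -f'' + V f`. -/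
def sturmExpr (V : ℝ → ℝ) (f : ℝ → ℂ) : ℝ → ℂ :=
  fun x => -deriv (deriv f) x + (V x : ℂ) * f x

/-- `f, f'` have one-sided limits at `p`, and `(f(p+), f'(p+))ᵀ = A (f(p-), f'(p-))ᵀ`. -/
def JumpCondition (A : Matrix (Fin 2) (Fin 2) ℝ) (f : ℝ → ℂ) (p : ℝ) : Prop :=
  ∃ l r : Fin 2 → ℂ,
    Tendsto f (𝓝[<] p) (𝓝 (l 0)) ∧ Tendsto (deriv f) (𝓝[<] p) (𝓝 (l 1)) ∧
    Tendsto f (𝓝[>] p) (𝓝 (r 0)) ∧ Tendsto (deriv f) (𝓝[>] p) (𝓝 (r 1)) ∧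
    r = (A.map (fun t : ℝ => (t : ℂ))).mulVec l

/-- `f` and `f'` are (locally) absolutely continuous in the set `U`: `f` is differentiable in `U`,
and `f`, `f'` are absolutely continuous on every compact interval contained in `U`. -/
structure LocallyAC₂ (f : ℝ → ℂ) (U : Set ℝ) : Prop where
  differentiableAt : ∀ y ∈ U, DifferentiableAt ℝ f y
  ac : ∀ c d : ℝ, c ≤ d → Icc c d ⊆ U → AbsolutelyContinuousOnInterval f c d
  ac_deriv : ∀ c d : ℝ, c ≤ d → Icc c d ⊆ U → AbsolutelyContinuousOnInterval (deriv f) c d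

/-- The set of eigenvalues of a (possibly unbounded) linear operator. -/
def pointSpectrum {H : Type*} [AddCommGroup H] [Module ℂ H] (T : H →ₗ.[ℂ] H) : Set ℂ :=
  {z | ∃ φ : T.domain, φ ≠ 0 ∧ T φ = z • (φ : H)}

/-- The non-random data: an interval `(a, b)` with `-∞ ≤ a < b ≤ ∞`, a real potential
`V ∈ L¹_loc(a, b)`, and distinct points `x n ∈ (a, b)`, `n ∈ idx ⊆ ℤ`, which
have no accumulation point in `(a, b)`. -/
structure SturmData where
  a : EReal
  b : EReal
  a_lt_b : a < b
  V : ℝ → ℝ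
  locallyIntegrable : LocallyIntegrableOn V {y : ℝ | a < y ∧ y < b} volume
  idx : Set ℤ
  x : idx → ℝ
  x_injective : Function.Injective x
  x_mem : ∀ n, a < x n ∧ x n < b
  not_accPt : ∀ y : ℝ, a < y → y < b → ¬ AccPt y (𝓟 (range x))

namespace SturmData

/-- The interval `(a, b)`. -/
def J (S : SturmData) : Set ℝ := {y : ℝ | S.a < y ∧ y < S.b}

/-- The set of interaction points. -/
def M (S : SturmData) : Set ℝ := range S.x

/-- Lebesgue measure on `(a, b)`. -/
def μ (S : SturmData) : Measure ℝ := volume.restrict S.J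

/-- The Hilbert space `L²(a, b)`. -/
abbrev L2 (S : SturmData) : Type := Lp ℂ 2 S.μ

/-- `f` is a solution of `(τ_{Λ,R,Θ} - z) f = g`. -/
structure IsSolution (S : SturmData) (Λ R Θ : S.idx → ℝ) (z : ℂ) (g f : ℝ → ℂ) : Prop where
  ac : LocallyAC₂ f (S.J \ S.M)
  eqn : ∀ᵐ y ∂S.μ, sturmExpr S.V f y - z * f y = g y
  jump : ∀ n, JumpCondition (interactionMatrix (Λ n) (R n) (Θ n)) f (S.x n)

/-- `f` is square integrable near `a` ("lies left in `L²(a, b)`"). -/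
def LiesLeft (S : SturmData) (f : ℝ → ℂ) : Prop :=
  ∃ c ∈ S.J, MemLp f 2 (volume.restrict (S.J ∩ Iio c))

/-- `f` is square integrable near `b` ("lies right in `L²(a, b)`"). -/
def LiesRight (S : SturmData) (f : ℝ → ℂ) : Prop :=
  ∃ c ∈ S.J, MemLp f 2 (volume.restrict (S.J ∩ Ioi c))

/-- `τ_{Λ,R,Θ}` is in the limit point case at `a`. -/
def LimitPointLeft (S : SturmData) (Λ R Θ : S.idx → ℝ) : Prop :=
  ∀ z : ℂ, ∃ f, S.IsSolution Λ R Θ z 0 f ∧ ¬ S.LiesLeft f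

/-- `τ_{Λ,R,Θ}` is in the limit point case at `b`. -/
def LimitPointRight (S : SturmData) (Λ R Θ : S.idx → ℝ) : Prop :=
  ∀ z : ℂ, ∃ f, S.IsSolution Λ R Θ z 0 f ∧ ¬ S.LiesRight f

/-- `τ_{Λ,R,Θ}` is regular at the (finite) left end point `a = a₀`. -/
structure RegularLeftAt (S : SturmData) (a₀ : ℝ) : Prop where
  eq : S.a = a₀
  locallyIntegrable : LocallyIntegrableOn S.V {y : ℝ | S.a ≤ y ∧ y < S.b} volume
  not_accPt : ¬ AccPt a₀ (𝓟 S.M)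

/-- `τ_{Λ,R,Θ}` is regular at the (finite) right end point `b = b₀`. -/
structure RegularRightAt (S : SturmData) (b₀ : ℝ) : Prop where
  eq : S.b = b₀
  locallyIntegrable : LocallyIntegrableOn S.V {y : ℝ | S.a < y ∧ y ≤ S.b} volume
  not_accPt : ¬ AccPt b₀ (𝓟 S.M)

/-- `τ_{Λ,R,Θ}` is regular at `a`. -/
def RegularLeft (S : SturmData) : Prop := ∃ a₀, S.RegularLeftAt a₀

/-- `τ_{Λ,R,Θ}` is regular at `b`. -/
def RegularRight (S : SturmData) : Prop := ∃ b₀, S.RegularRightAt b₀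

/-- `f cos ψ + f' sin ψ = 0` in the limit along the filter `l`, where `f`, `f'` have limits. -/
def BoundaryCondition (ψ : ℝ) (f : ℝ → ℂ) (l : Filter ℝ) : Prop :=
  ∃ p p' : ℂ, Tendsto f l (𝓝 p) ∧ Tendsto (deriv f) l (𝓝 p') ∧
    p * (Real.cos ψ : ℂ) + p' * (Real.sin ψ : ℂ) = 0

/-- The functions in the domain of the maximal operator `T_{Λ,R,Θ}`. -/
structure InMaxDomain (S : SturmData) (Λ R Θ : S.idx → ℝ) (f : ℝ → ℂ) : Prop where
  memLp : MemLp f 2 S.μ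
  ac : LocallyAC₂ f (S.J \ S.M)
  memLp_expr : MemLp (sturmExpr S.V f) 2 S.μ
  jump : ∀ n, JumpCondition (interactionMatrix (Λ n) (R n) (Θ n)) f (S.x n)

/-- The functions in the domain of `H_{Λ,R,Θ}`: at a regular end point the separated
real boundary condition with angle `ψa` (resp. `ψb`) is imposed; at a limit point end point,
which is never regular, there is no boundary condition. -/
structure InDomain (S : SturmData) (ψa ψb : ℝ) (Λ R Θ : S.idx → ℝ) (f : ℝ → ℂ) : Prop where
  max : S.InMaxDomain Λ R Θ f
  left : ∀ a₀, S.RegularLeftAt a₀ → BoundaryCondition ψa f (𝓝[>] a₀)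
  right : ∀ b₀, S.RegularRightAt b₀ → BoundaryCondition ψb f (𝓝[<] b₀)

end SturmData

/-! Closure properties, needed for the operator to be well defined and linear. -/

lemma LocallyAC₂.zero (U : Set ℝ) : LocallyAC₂ 0 U := by
  have h : deriv (0 : ℝ → ℂ) = 0 := by ext y; simp
  have h0 : ∀ c d : ℝ, AbsolutelyContinuousOnInterval (0 : ℝ → ℂ) c d := fun c d => by
    have := (contDiff_const (𝕜 := ℝ) (n := 1) (c := (0 : ℂ)) (E := ℝ)).contDiffOn
      (s := uIcc c d) |>.absolutelyContinuousOnInterval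
    exact this
  exact ⟨fun y _ => differentiableAt_const _, fun c d _ _ => h0 c d,
    fun c d _ _ => by rw [h]; exact h0 c d⟩

lemma AbsolutelyContinuousOnInterval.congr_Icc {f g : ℝ → ℂ} {c d : ℝ} (hcd : c ≤ d)
    (hf : AbsolutelyContinuousOnInterval f c d) (h : EqOn g f (Icc c d)) :
    AbsolutelyContinuousOnInterval g c d := by
  rw [absolutelyContinuousOnInterval_iff] at hf ⊢
  intro ε hε
  obtain ⟨δ, hδ, H⟩ := hf ε hε
  refine ⟨δ, hδ, fun E hE hlt => ?_⟩
  have h2 := H E hE hlt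
  have hmem := hE.1
  rw [uIcc_of_le hcd] at hmem
  rwa [Finset.sum_congr rfl fun i hi => by
    rw [h (hmem i hi).1, h (hmem i hi).2]]

lemma LocallyAC₂.add {f g : ℝ → ℂ} {U : Set ℝ} (hf : LocallyAC₂ f U) (hg : LocallyAC₂ g U) :
    LocallyAC₂ (f + g) U := by
  refine ⟨fun y hy => (hf.1 y hy).add (hg.1 y hy),
    fun c d h h' => (hf.2 c d h h').add (hg.2 c d h h'), fun c d h h' => ?_⟩
  refine ((hf.3 c d h h').add (hg.3 c d h h')).congr_Icc h fun y hy => ?_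
  exact deriv_add (hf.1 y (h' hy)) (hg.1 y (h' hy))

lemma deriv_const_smul_eq (k : ℂ) (f : ℝ → ℂ) : deriv (k • f) = k • deriv f := by
  ext y
  exact deriv_const_smul_field k f

lemma LocallyAC₂.smul {f : ℝ → ℂ} {U : Set ℝ} (k : ℂ) (hf : LocallyAC₂ f U) :
    LocallyAC₂ (k • f) U := by
  refine ⟨fun y hy => (hf.1 y hy).const_smul k,
    fun c d h h' => (hf.2 c d h h').const_smul k, fun c d h h' => ?_⟩
  rw [deriv_const_smul_eq]
  exact (hf.3 c d h h').const_smul k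

lemma LocallyAC₂.ae_differentiableAt {f : ℝ → ℂ} {U : Set ℝ} (hU : IsOpen U)
    (hf : LocallyAC₂ f U) : ∀ᵐ y, y ∈ U → DifferentiableAt ℝ (deriv f) y := by
  rw [ae_iff]
  refine measure_null_of_locally_null _ fun y hy => ?_
  simp only [mem_ofPred_eq, Classical.not_imp] at hy
  obtain ⟨ε, hε, hsub⟩ := Metric.nhds_basis_closedBall.mem_iff.1 (hU.mem_nhds hy.1)
  rw [Real.closedBall_eq_Icc] at hsub
  have hle : y - ε ≤ y + ε := by linarith
  have hae := (hf.3 _ _ hle hsub).boundedVariationOn.ae_differentiableAt_of_mem_uIcc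
  refine ⟨{y | ¬(y ∈ U → DifferentiableAt ℝ (deriv f) y)} ∩ Icc (y - ε) (y + ε),
    inter_mem self_mem_nhdsWithin (mem_nhdsWithin_of_mem_nhds
      (Icc_mem_nhds (by linarith) (by linarith))), ?_⟩
  refine measure_mono_null ?_ (ae_iff.1 hae)
  rintro w ⟨hw, hw'⟩
  simp only [mem_ofPred_eq, Classical.not_imp] at hw ⊢
  exact ⟨by rwa [uIcc_of_le hle], hw.2⟩

lemma LocallyAC₂.deriv_add_eventuallyEq {f g : ℝ → ℂ} {U : Set ℝ} (hf : LocallyAC₂ f U)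
    (hg : LocallyAC₂ g U) {l : Filter ℝ} (hl : U ∈ l) :
    deriv (f + g) =ᶠ[l] deriv f + deriv g := by
  filter_upwards [hl] with y hy
  exact deriv_add (hf.1 y hy) (hg.1 y hy)

lemma JumpCondition.zero (A : Matrix (Fin 2) (Fin 2) ℝ) (p : ℝ) : JumpCondition A 0 p := by
  have h : deriv (0 : ℝ → ℂ) = 0 := by ext y; simp
  refine ⟨0, 0, ?_, ?_, ?_, ?_, by simp⟩
  · exact tendsto_const_nhds
  · rw [h]; exact tendsto_const_nhds
  · exact tendsto_const_nhds
  · rw [h]; exact tendsto_const_nhds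

lemma JumpCondition.add {A : Matrix (Fin 2) (Fin 2) ℝ} {f g : ℝ → ℂ} {p : ℝ} {U : Set ℝ}
    (hf : JumpCondition A f p) (hg : JumpCondition A g p)
    (hf' : LocallyAC₂ f U) (hg' : LocallyAC₂ g U) (hU : U ∈ 𝓝[≠] p) :
    JumpCondition A (f + g) p := by
  obtain ⟨l, r, h1, h2, h3, h4, h5⟩ := hf
  obtain ⟨l', r', h1', h2', h3', h4', h5'⟩ := hg
  have hl : U ∈ 𝓝[<] p := nhdsWithin_mono p (fun y hy => ne_of_lt hy) hU
  have hr : U ∈ 𝓝[>] p := nhdsWithin_mono p (fun y hy => ne_of_gt hy) hU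
  exact ⟨l + l', r + r', h1.add h1',
    (h2.add h2').congr' (hf'.deriv_add_eventuallyEq hg' hl).symm, h3.add h3',
    (h4.add h4').congr' (hf'.deriv_add_eventuallyEq hg' hr).symm,
    by rw [Matrix.mulVec_add, h5, h5']⟩

lemma JumpCondition.smul {A : Matrix (Fin 2) (Fin 2) ℝ} {f : ℝ → ℂ} {p : ℝ} (k : ℂ)
    (hf : JumpCondition A f p) : JumpCondition A (k • f) p := by
  obtain ⟨l, r, h1, h2, h3, h4, h5⟩ := hf
  refine ⟨k • l, k • r, h1.const_smul k, ?_, h3.const_smul k, ?_, ?_⟩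
  · rw [deriv_const_smul_eq]; exact h2.const_smul k
  · rw [deriv_const_smul_eq]; exact h4.const_smul k
  · rw [Matrix.mulVec_smul, h5]

namespace SturmData

lemma BoundaryCondition.zero (ψ : ℝ) (l : Filter ℝ) : BoundaryCondition ψ 0 l := by
  have h : deriv (0 : ℝ → ℂ) = 0 := by ext y; simp
  refine ⟨0, 0, tendsto_const_nhds, ?_, by simp⟩
  rw [h]; exact tendsto_const_nhds

lemma BoundaryCondition.add {ψ : ℝ} {f g : ℝ → ℂ} {l : Filter ℝ} {U : Set ℝ}
    (hf : BoundaryCondition ψ f l) (hg : BoundaryCondition ψ g l)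
    (hf' : LocallyAC₂ f U) (hg' : LocallyAC₂ g U) (hU : U ∈ l) :
    BoundaryCondition ψ (f + g) l := by
  obtain ⟨p, p', h1, h2, h3⟩ := hf
  obtain ⟨q, q', k1, k2, k3⟩ := hg
  refine ⟨p + q, p' + q', h1.add k1,
    (h2.add k2).congr' (hf'.deriv_add_eventuallyEq hg' hU).symm, ?_⟩
  linear_combination h3 + k3

lemma BoundaryCondition.smul {ψ : ℝ} {f : ℝ → ℂ} {l : Filter ℝ} (k : ℂ)
    (hf : BoundaryCondition ψ f l) : BoundaryCondition ψ (k • f) l := by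
  obtain ⟨p, p', h1, h2, h3⟩ := hf
  refine ⟨k * p, k * p', h1.const_smul k, ?_, by linear_combination k * h3⟩
  rw [deriv_const_smul_eq]; exact h2.const_smul k

variable (S : SturmData)

lemma isOpen_J : IsOpen S.J :=
  (isOpen_lt continuous_const continuous_coe_real_ereal).inter
    (isOpen_lt continuous_coe_real_ereal continuous_const)

lemma compl_M_mem {y : ℝ} (h : ¬ AccPt y (𝓟 S.M)) : S.Mᶜ ∈ 𝓝[≠] y := by
  rw [AccPt, neBot_iff, not_not, inf_principal_eq_bot] at h
  exact h

lemma diff_mem_punctured {y : ℝ} (hy : y ∈ S.J) : S.J \ S.M ∈ 𝓝[≠] y :=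
  inter_mem (mem_nhdsWithin_of_mem_nhds (S.isOpen_J.mem_nhds hy))
    (S.compl_M_mem (S.not_accPt y hy.1 hy.2))

lemma isOpen_diff : IsOpen (S.J \ S.M) := by
  rw [isOpen_iff_mem_nhds]
  intro y hy
  have h := S.diff_mem_punctured hy.1
  rw [mem_nhdsWithin_iff_eventually] at h
  filter_upwards [h] with w hw
  by_cases hwy : w = y
  · rwa [hwy]
  · exact hw hwy

lemma ae_mem_diff : ∀ᵐ y ∂S.μ, y ∈ S.J \ S.M := by
  have h1 : ∀ᵐ y ∂S.μ, y ∈ S.J := ae_restrict_mem S.isOpen_J.measurableSet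
  have h2 : ∀ᵐ y ∂S.μ, y ∉ S.M := ae_restrict_of_ae ((countable_range S.x).ae_notMem volume)
  filter_upwards [h1, h2] with y hy hy' using ⟨hy, hy'⟩

variable {S}

lemma RegularLeftAt.mem {a₀ : ℝ} (h : S.RegularLeftAt a₀) : S.J \ S.M ∈ 𝓝[>] a₀ := by
  refine inter_mem ?_ (nhdsWithin_mono a₀ (fun y hy => ne_of_gt hy) (S.compl_M_mem h.not_accPt))
  have hb : {y : ℝ | (y : EReal) < S.b} ∈ 𝓝[>] a₀ :=
    mem_nhdsWithin_of_mem_nhds ((isOpen_lt continuous_coe_real_ereal continuous_const).mem_nhds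
      (by have := S.a_lt_b; rwa [h.eq] at this))
  filter_upwards [hb, self_mem_nhdsWithin] with y hy hy'
  exact ⟨by rw [h.eq]; exact_mod_cast hy', hy⟩

lemma RegularRightAt.mem {b₀ : ℝ} (h : S.RegularRightAt b₀) : S.J \ S.M ∈ 𝓝[<] b₀ := by
  refine inter_mem ?_ (nhdsWithin_mono b₀ (fun y hy => ne_of_lt hy) (S.compl_M_mem h.not_accPt))
  have hb : {y : ℝ | S.a < (y : EReal)} ∈ 𝓝[<] b₀ :=
    mem_nhdsWithin_of_mem_nhds ((isOpen_lt continuous_const continuous_coe_real_ereal).mem_nhds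
      (by have := S.a_lt_b; rwa [h.eq] at this))
  filter_upwards [hb, self_mem_nhdsWithin] with y hy hy'
  exact ⟨hy, by rw [h.eq]; exact_mod_cast hy'⟩

lemma expr_add {f g : ℝ → ℂ} (hf : LocallyAC₂ f (S.J \ S.M)) (hg : LocallyAC₂ g (S.J \ S.M)) :
    sturmExpr S.V (f + g) =ᵐ[S.μ] sturmExpr S.V f + sturmExpr S.V g := by
  filter_upwards [S.ae_mem_diff, ae_restrict_of_ae (hf.ae_differentiableAt S.isOpen_diff),
    ae_restrict_of_ae (hg.ae_differentiableAt S.isOpen_diff)] with y hy h1 h2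
  have h3 : deriv (deriv (f + g)) y = deriv (deriv f) y + deriv (deriv g) y := by
    rw [(hf.deriv_add_eventuallyEq hg (S.isOpen_diff.mem_nhds hy)).deriv_eq]
    exact deriv_add (h1 hy) (h2 hy)
  simp only [sturmExpr, Pi.add_apply, h3]
  ring

lemma expr_smul (k : ℂ) (f : ℝ → ℂ) : sturmExpr S.V (k • f) = k • sturmExpr S.V f := by
  ext y
  simp only [sturmExpr, deriv_const_smul_eq, Pi.smul_apply, smul_eq_mul]
  ring

lemma expr_congr {f g : ℝ → ℂ} (hf : LocallyAC₂ f (S.J \ S.M)) (hg : LocallyAC₂ g (S.J \ S.M))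
    (h : f =ᵐ[S.μ] g) : sturmExpr S.V f =ᵐ[S.μ] sturmExpr S.V g := by
  have hU := S.isOpen_diff
  have h' : f =ᵐ[volume.restrict (S.J \ S.M)] g := ae_restrict_of_ae_restrict_of_subset
    sdiff_subset h
  have heq : EqOn f g (S.J \ S.M) := Measure.eqOn_open_of_ae_eq h' hU
    (fun y hy => (hf.1 y hy).continuousAt.continuousWithinAt)
    (fun y hy => (hg.1 y hy).continuousAt.continuousWithinAt)
  filter_upwards [S.ae_mem_diff] with y hy
  have e : f =ᶠ[𝓝 y] g := heq.eventuallyEq_of_mem (hU.mem_nhds hy)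
  simp only [sturmExpr, e.deriv.deriv_eq, heq hy]

variable {ψa ψb : ℝ} {Λ R Θ : S.idx → ℝ}

lemma InDomain.zero : S.InDomain ψa ψb Λ R Θ 0 := by
  refine ⟨⟨MemLp.zero', LocallyAC₂.zero _, ?_, fun n => JumpCondition.zero _ _⟩,
    fun _ _ => BoundaryCondition.zero _ _, fun _ _ => BoundaryCondition.zero _ _⟩
  have h : deriv (0 : ℝ → ℂ) = 0 := by ext y; simp
  have h0 : sturmExpr S.V 0 = 0 := by
    ext y
    simp [sturmExpr, h]
  rw [h0]; exact MemLp.zero'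

lemma InDomain.add {f g : ℝ → ℂ} (hf : S.InDomain ψa ψb Λ R Θ f)
    (hg : S.InDomain ψa ψb Λ R Θ g) : S.InDomain ψa ψb Λ R Θ (f + g) :=
  ⟨⟨hf.max.memLp.add hg.max.memLp, hf.max.ac.add hg.max.ac,
    (hf.max.memLp_expr.add hg.max.memLp_expr).ae_eq (expr_add hf.max.ac hg.max.ac).symm,
    fun n => (hf.max.jump n).add (hg.max.jump n) hf.max.ac hg.max.ac
      (S.diff_mem_punctured (S.x_mem n))⟩,
    fun a₀ h => (hf.left a₀ h).add (hg.left a₀ h) hf.max.ac hg.max.ac h.mem,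
    fun b₀ h => (hf.right b₀ h).add (hg.right b₀ h) hf.max.ac hg.max.ac h.mem⟩

lemma InDomain.smul {f : ℝ → ℂ} (k : ℂ) (hf : S.InDomain ψa ψb Λ R Θ f) :
    S.InDomain ψa ψb Λ R Θ (k • f) :=
  ⟨⟨hf.max.memLp.const_smul k, hf.max.ac.smul k,
    by rw [expr_smul]; exact hf.max.memLp_expr.const_smul k, fun n => (hf.max.jump n).smul k⟩,
    fun a₀ h => (hf.left a₀ h).smul k, fun b₀ h => (hf.right b₀ h).smul k⟩

variable (S ψa ψb Λ R Θ)

/-- The domain `D(H_{Λ,R,Θ})`, as a subspace of `L²(a, b)`: the classes that have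
a representative satisfying the conditions of the domain. -/
def domain : Submodule ℂ S.L2 where
  carrier := {φ | ∃ f, S.InDomain ψa ψb Λ R Θ f ∧ φ =ᵐ[S.μ] f}
  zero_mem' := ⟨0, InDomain.zero, Lp.coeFn_zero _ _ _⟩
  add_mem' := by
    rintro φ χ ⟨f, hf, hφ⟩ ⟨g, hg, hχ⟩
    exact ⟨f + g, hf.add hg, (Lp.coeFn_add φ χ).trans (hφ.add hχ)⟩
  smul_mem' := by
    rintro k φ ⟨f, hf, hφ⟩
    exact ⟨k • f, hf.smul k, (Lp.coeFn_smul k φ).trans (hφ.const_smul k)⟩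

/-- A representative of an element of the domain. -/
def rep (φ : S.domain ψa ψb Λ R Θ) : ℝ → ℂ := φ.2.choose

lemma rep_inDomain (φ : S.domain ψa ψb Λ R Θ) :
    S.InDomain ψa ψb Λ R Θ (S.rep ψa ψb Λ R Θ φ) := φ.2.choose_spec.1

lemma coe_ae_eq_rep (φ : S.domain ψa ψb Λ R Θ) :
    (φ : S.L2) =ᵐ[S.μ] S.rep ψa ψb Λ R Θ φ := φ.2.choose_spec.2

/-- The operator `H_{Λ,R,Θ}` in `L²(a, b)`: `H φ = τ f` for every (equivalently, some)
representative `f` of `φ` that satisfies the conditions of the domain. -/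
def hamiltonian : S.L2 →ₗ.[ℂ] S.L2 where
  domain := S.domain ψa ψb Λ R Θ
  toFun :=
    { toFun := fun φ => (S.rep_inDomain ψa ψb Λ R Θ φ).max.memLp_expr.toLp _
      map_add' := by
        intro φ χ
        have hφ := S.rep_inDomain ψa ψb Λ R Θ φ
        have hχ := S.rep_inDomain ψa ψb Λ R Θ χ
        have hs := S.rep_inDomain ψa ψb Λ R Θ (φ + χ)
        rw [← MemLp.toLp_add, MemLp.toLp_eq_toLp_iff]
        refine (expr_congr hs.max.ac (hφ.max.ac.add hχ.max.ac) ?_).trans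
          (expr_add hφ.max.ac hχ.max.ac)
        exact (S.coe_ae_eq_rep ψa ψb Λ R Θ (φ + χ)).symm.trans
          ((Lp.coeFn_add (φ : S.L2) (χ : S.L2)).trans
            ((S.coe_ae_eq_rep ψa ψb Λ R Θ φ).add (S.coe_ae_eq_rep ψa ψb Λ R Θ χ)))
      map_smul' := by
        intro k φ
        have hφ := S.rep_inDomain ψa ψb Λ R Θ φ
        have hs := S.rep_inDomain ψa ψb Λ R Θ (k • φ)
        rw [RingHom.id_apply, ← MemLp.toLp_const_smul, MemLp.toLp_eq_toLp_iff, ← expr_smul]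
        refine expr_congr hs.max.ac (hφ.max.ac.smul k) ?_
        exact (S.coe_ae_eq_rep ψa ψb Λ R Θ (k • φ)).symm.trans
          ((Lp.coeFn_smul k (φ : S.L2)).trans
            ((S.coe_ae_eq_rep ψa ψb Λ R Θ φ).const_smul k)) }

/-- The value of the operator does not depend on the representative. -/
lemma hamiltonian_ae_eq (φ : (S.hamiltonian ψa ψb Λ R Θ).domain) {f : ℝ → ℂ}
    (hf : S.InDomain ψa ψb Λ R Θ f) (h : (φ : S.L2) =ᵐ[S.μ] f) :
    S.hamiltonian ψa ψb Λ R Θ φ =ᵐ[S.μ] sturmExpr S.V f :=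
  (MemLp.coeFn_toLp (S.rep_inDomain ψa ψb Λ R Θ φ).max.memLp_expr).trans
    (expr_congr (S.rep_inDomain ψa ψb Λ R Θ φ).max.ac hf.max.ac
      ((S.coe_ae_eq_rep ψa ψb Λ R Θ φ).symm.trans h))

end SturmData

end

/-! Freeze every angle except the one at `p = x n₀`. Suppose that `E` is an eigenvalue for two
choices `θ`, `s` of this angle, with eigenfunctions `f` and `g`. Off `p` they solve the same
problem, so on each side of `p` their Wronskian is constant, and the behaviour at the end point
makes it zero. At a regular end both satisfy the same boundary condition. At a limit point end a
nonzero Wronskian would make every solution a combination of `f` and `g`, hence square integrable.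
As `E`, `V`, the matrices and the boundary conditions are real, the conjugate of `g` may replace
`g`.

Let `l`, `m` be the Cauchy data of `f`, `g` at `p-`. They are nonzero, and `l` is parallel to `m`
and to `star m`; the data at `p+` of `f` and of the conjugate of `g` are parallel too. The factors
`P_α H_r` have determinant one and do not change the Wronskian, so passing through `p` amounts to a
relative rotation by `s - θ`. It turns the zero Wronskian into `sin (s - θ)` times the Hermitian
product of `l` and `m`, which is nonzero for parallel nonzero vectors. Hence `sin (s - θ) = 0`
(`SturmData.sin_sub_eq_zero_of_mem_pointSpectrum`).

So, the other angles being fixed, the exceptional values of the angle at `n₀` form a countable set,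
null for a measure without atoms. Resampling the coordinate `n₀` preserves the product measure, and
Fubini concludes (`MeasureTheory.Measure.infinitePi_null_of_update_null`). -/

/-! ### Absolute continuity and `u'' = Q u` away from the interaction points -/

/-- The Wronskian `f g' - f' g`. -/
noncomputable def wronskian (f g : ℝ → ℂ) (y : ℝ) : ℂ := f y * deriv g y - deriv f y * g y

/-- Meant for real parts, imaginary parts and conjugates, which do not increase distances. -/
theorem AbsolutelyContinuousOnInterval.of_dist_le {X Y : Type*} [PseudoMetricSpace X]
    [PseudoMetricSpace Y] {f : ℝ → X} {g : ℝ → Y} {c d : ℝ}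
    (hf : AbsolutelyContinuousOnInterval f c d) (h : ∀ x y, dist (g x) (g y) ≤ dist (f x) (f y)) :
    AbsolutelyContinuousOnInterval g c d := by
  rw [absolutelyContinuousOnInterval_iff] at hf ⊢
  intro ε hε
  obtain ⟨δ, hδ, H⟩ := hf ε hε
  exact ⟨δ, hδ, fun I hI hlt => (Finset.sum_le_sum fun i _ => h _ _).trans_lt (H I hI hlt)⟩

/-- A real absolutely continuous function is controlled by the integral of a bound on its
derivative. -/
theorem AbsolutelyContinuousOnInterval.abs_sub_le_integral {f h : ℝ → ℝ} {c d : ℝ} (hcd : c ≤ d)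
    (hf : AbsolutelyContinuousOnInterval f c d) (hh : IntervalIntegrable h volume c d)
    (hle : ∀ᵐ x, x ∈ Icc c d → |deriv f x| ≤ h x) :
    |f d - f c| ≤ ∫ x in c..d, h x := by
  rw [← hf.integral_deriv_eq_sub, ← Real.norm_eq_abs]
  refine intervalIntegral.norm_integral_le_of_norm_le hcd ?_ hh
  filter_upwards [hle] with x hx hx'
  exact hx (Ioc_subset_Icc_self hx')

/-- The factor 2 comes from adding the real bounds for the real and imaginary parts. It is not
sharp, but only smallness of the integral matters later. -/
theorem AbsolutelyContinuousOnInterval.norm_sub_le_integral {f : ℝ → ℂ} {h : ℝ → ℝ} {c d : ℝ}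
    (hcd : c ≤ d) (hf : AbsolutelyContinuousOnInterval f c d)
    (hh : IntervalIntegrable h volume c d)
    (hle : ∀ᵐ x, x ∈ Icc c d → ‖deriv f x‖ ≤ h x) :
    ‖f d - f c‖ ≤ 2 * ∫ x in c..d, h x := by
  have hd := hf.boundedVariationOn.ae_differentiableAt_of_mem_uIcc
  rw [uIcc_of_le hcd] at hd
  have hre := AbsolutelyContinuousOnInterval.abs_sub_le_integral (f := fun x => (f x).re) hcd
    (hf.of_dist_le fun x y => by
      rw [Real.dist_eq, dist_eq_norm, ← Complex.sub_re]; exact Complex.abs_re_le_norm _) hh (by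
    filter_upwards [hd, hle] with x h1 h2 hx
    have h3 : HasDerivAt (fun x => (f x).re) (deriv f x).re x :=
      Complex.reCLM.hasFDerivAt.comp_hasDerivAt x (h1 hx).hasDerivAt
    rw [h3.deriv]
    exact (Complex.abs_re_le_norm _).trans (h2 hx))
  have him := AbsolutelyContinuousOnInterval.abs_sub_le_integral (f := fun x => (f x).im) hcd
    (hf.of_dist_le fun x y => by
      rw [Real.dist_eq, dist_eq_norm, ← Complex.sub_im]; exact Complex.abs_im_le_norm _) hh (by
    filter_upwards [hd, hle] with x h1 h2 hx
    have h3 : HasDerivAt (fun x => (f x).im) (deriv f x).im x :=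
      Complex.imCLM.hasFDerivAt.comp_hasDerivAt x (h1 hx).hasDerivAt
    rw [h3.deriv]
    exact (Complex.abs_im_le_norm _).trans (h2 hx))
  have := Complex.norm_le_abs_re_add_abs_im (f d - f c)
  simp only [Complex.sub_re, Complex.sub_im] at this
  linarith

namespace LocallyAC₂

variable {f g : ℝ → ℂ} {U : Set ℝ}

theorem mono {U' : Set ℝ} (hf : LocallyAC₂ f U) (h : U' ⊆ U) : LocallyAC₂ f U' :=
  ⟨fun y hy => hf.1 y (h hy), fun c d hcd hU => hf.2 c d hcd (hU.trans h),
    fun c d hcd hU => hf.3 c d hcd (hU.trans h)⟩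

theorem continuousAt_deriv (hU : IsOpen U) (hf : LocallyAC₂ f U) {y : ℝ} (hy : y ∈ U) :
    ContinuousAt (deriv f) y := by
  obtain ⟨ε, hε, hsub⟩ := Metric.nhds_basis_closedBall.mem_iff.1 (hU.mem_nhds hy)
  rw [Real.closedBall_eq_Icc] at hsub
  have hle : y - ε ≤ y + ε := by linarith
  have h := (hf.3 _ _ hle hsub).continuousOn
  rw [uIcc_of_le hle] at h
  exact h.continuousAt (Icc_mem_nhds (by linarith) (by linarith))

theorem star (hf : LocallyAC₂ f U) : LocallyAC₂ (fun y => star (f y)) U := by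
  refine ⟨fun y hy => (hf.1 y hy).star, fun c d hcd h => ?_, fun c d hcd h => ?_⟩
  · exact (hf.2 c d hcd h).of_dist_le fun x y => (dist_star_star _ _).le
  · rw [deriv.star']
    exact (hf.3 c d hcd h).of_dist_le fun x y => (dist_star_star _ _).le

/-- The Wronskian of two solutions of `u'' = Q u` is constant on intervals. -/
theorem wronskian_eq (hf : LocallyAC₂ f U) (hg : LocallyAC₂ g U) (hU : IsOpen U) {Q : ℝ → ℂ}
    (hf' : ∀ᵐ y, y ∈ U → deriv (deriv f) y = Q y * f y)
    (hg' : ∀ᵐ y, y ∈ U → deriv (deriv g) y = Q y * g y)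
    {c d : ℝ} (hcd : c ≤ d) (hsub : Icc c d ⊆ U) : wronskian f g c = wronskian f g d := by
  have hW : AbsolutelyContinuousOnInterval (wronskian f g) c d :=
    ((hf.2 c d hcd hsub).smul (hg.3 c d hcd hsub)).sub
      ((hf.3 c d hcd hsub).smul (hg.2 c d hcd hsub))
  -- The derivative of `f g' - f' g` is `f g'' - f'' g`, which vanishes almost everywhere; absolute
  -- continuity then gives constancy.
  obtain ⟨C, hC⟩ := hW.const_of_ae_hasDerivAt_zero (by
    rw [uIcc_of_le hcd]
    filter_upwards [hf', hg', hf.ae_differentiableAt hU, hg.ae_differentiableAt hU]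
      with y h1 h2 h3 h4 hy
    have hy := hsub hy
    have := ((hf.1 y hy).hasDerivAt.mul (h4 hy).hasDerivAt).sub
      ((h3 hy).hasDerivAt.mul (hg.1 y hy).hasDerivAt)
    refine this.congr_deriv ?_
    rw [h1 hy, h2 hy]
    ring)
  rw [hC c left_mem_uIcc, hC d right_mem_uIcc]

/-- Local stability of the Cauchy problem for `u'' = Q u`. -/
theorem norm_add_norm_le (hf : LocallyAC₂ f U) {Q : ℝ → ℂ}
    (hf' : ∀ᵐ y, y ∈ U → deriv (deriv f) y = Q y * f y)
    {c d : ℝ} (hcd : c ≤ d) (hsub : Icc c d ⊆ U) (hQ : IntervalIntegrable Q volume c d)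
    (hsmall : ∫ x in c..d, (1 + ‖Q x‖) ≤ 1 / 4) {s t : ℝ} (hs : s ∈ Icc c d) (ht : t ∈ Icc c d) :
    ‖f t‖ + ‖deriv f t‖ ≤ 2 * (‖f s‖ + ‖deriv f s‖) := by
  have hc1 := (hf.2 c d hcd hsub).continuousOn
  have hc2 := (hf.3 c d hcd hsub).continuousOn
  rw [uIcc_of_le hcd] at hc1 hc2
  -- With `m` the maximum of `‖f‖ + ‖f'‖`, the derivatives of `f` and `f'` are bounded by `m` and
  -- `‖Q‖ m`. The total change between two points is then at most `2 * (1 / 4) * m = m / 2`, so `m`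
  -- is at most twice the value at any `s`.
  obtain ⟨t₀, ht₀, hmax⟩ := isCompact_Icc.exists_isMaxOn (nonempty_Icc.2 hcd)
    (hc1.norm.add hc2.norm)
  set m := ‖f t₀‖ + ‖deriv f t₀‖ with hm
  have hmax' : ∀ x ∈ Icc c d, ‖f x‖ + ‖deriv f x‖ ≤ m := fun x hx => hmax hx
  have hm0 : 0 ≤ m := by positivity
  have hi : IntervalIntegrable (fun x => 1 + ‖Q x‖) volume c d :=
    intervalIntegrable_const.add hQ.norm
  have key : ∀ u v, c ≤ u → u ≤ v → v ≤ d →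
      ‖f v - f u‖ + ‖deriv f v - deriv f u‖ ≤ m / 2 := by
    intro u v hu huv hv
    have hsub' : Icc u v ⊆ Icc c d := Icc_subset_Icc hu hv
    have hsubu : uIcc u v ⊆ uIcc c d := by rwa [uIcc_of_le hcd, uIcc_of_le huv]
    have hQ' := hQ.mono_set hsubu
    have h1 := (hf.2 u v huv (hsub'.trans hsub)).norm_sub_le_integral (h := fun _ => m) huv
      intervalIntegrable_const (ae_of_all _ fun x hx => by
        have := hmax' x (hsub' hx); linarith [norm_nonneg (f x)])
    have h2 := (hf.3 u v huv (hsub'.trans hsub)).norm_sub_le_integral (h := fun x => ‖Q x‖ * m)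
      huv (hQ'.norm.mul_const m) (by
        filter_upwards [hf'] with x h hx
        rw [h (hsub (hsub' hx)), norm_mul]
        have := hmax' x (hsub' hx)
        gcongr
        linarith [norm_nonneg (deriv f x)])
    have h3 : ∫ x in u..v, (1 + ‖Q x‖) ≤ ∫ x in c..d, (1 + ‖Q x‖) :=
      intervalIntegral.integral_mono_interval hu huv hv (ae_of_all _ fun x => by
        show 0 ≤ 1 + ‖Q x‖; positivity) hi
    have h4 : (∫ x in u..v, (1 + ‖Q x‖)) = (∫ x in u..v, (1 : ℝ)) + ∫ x in u..v, ‖Q x‖ :=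
      intervalIntegral.integral_add intervalIntegrable_const hQ'.norm
    rw [intervalIntegral.integral_mul_const] at h2
    have h5 : ∫ x in u..v, m = (∫ x in u..v, (1 : ℝ)) * m := by
      simp
    rw [h5] at h1
    have h6 : (∫ x in u..v, (1 + ‖Q x‖)) * m ≤ 1 / 4 * m :=
      mul_le_mul_of_nonneg_right (h3.trans hsmall) hm0
    rw [h4, add_mul] at h6
    linarith
  have key' : ‖f t₀ - f s‖ + ‖deriv f t₀ - deriv f s‖ ≤ m / 2 := by
    rcases le_total s t₀ with h | h
    · exact key s t₀ hs.1 h ht₀.2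
    · have := key t₀ s ht₀.1 h hs.2
      rwa [norm_sub_rev, norm_sub_rev (deriv f s)] at this
  have e1 := norm_le_norm_add_norm_sub' (f t₀) (f s)
  have e2 := norm_le_norm_add_norm_sub' (deriv f t₀) (deriv f s)
  have := hmax' t ht
  linarith

end LocallyAC₂

/-! ### Solutions across interaction points -/

/-- A function that is locally constant off an isolated set of exceptions is constant off the
exceptions. -/
theorem IsPreconnected.eq_of_locally_eq_off {α : Type*} {W : ℝ → α} {K M : Set ℝ}
    (hK : IsPreconnected K) (hM : ∀ p ∈ K, Mᶜ ∈ 𝓝[≠] p)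
    (h : ∀ p ∈ K, ∃ k, ∀ᶠ y in 𝓝 p, y ∉ M → W y = k) {c d : ℝ} (hc : c ∈ K) (hd : d ∈ K)
    (hcM : c ∉ M) (hdM : d ∉ M) : W c = W d := by
  have : Nonempty α := ⟨W 0⟩
  -- `k p` is the value of `W` near `p` off `M`. Near `p`, each `y` has points off `M` arbitrarily
  -- close to it where both `k y` and `k p` are attained, so `k` is locally constant even at the
  -- exceptions.
  choose! k hk using h
  have hkW : ∀ p ∈ K, p ∉ M → k p = W p := fun p hp hpM => ((hk p hp).self_of_nhds hpM).symm
  have hloc : ∀ p ∈ K, ∀ᶠ y in 𝓝[K] p, k y = k p := by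
    intro p hp
    filter_upwards [mem_nhdsWithin_of_mem_nhds (hk p hp).eventually_nhds, self_mem_nhdsWithin]
      with y hy hyK
    obtain ⟨w, h1, h2, h3⟩ := ((eventually_mem_set.2 (hM y hyK)).and
      ((hy.filter_mono nhdsWithin_le_nhds).and ((hk y hyK).filter_mono nhdsWithin_le_nhds))).exists
    exact (h3 h1).symm.trans (h2 h1)
  rw [← hkW c hc hcM, ← hkW d hd hdM]
  -- For the discrete topology, locally constant means continuous, and preconnectedness applies.
  let _ : TopologicalSpace α := ⊥
  have : DiscreteTopology α := ⟨rfl⟩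
  refine hK.constant (f := k) (fun p hp => ?_) hc hd
  exact (tendsto_nhds_of_eventually_eq (hloc p hp) :)

namespace SturmData

variable {S : SturmData}

/-- `f` solves `(τ - z) f = 0` in the set `K`, with the matrix `A n` at each point `x n ∈ K`. -/
structure IsSolutionOn (S : SturmData) (A : S.idx → Matrix (Fin 2) (Fin 2) ℝ) (z : ℂ) (K : Set ℝ)
    (f : ℝ → ℂ) : Prop where
  ac : LocallyAC₂ f (K \ S.M)
  eqn : ∀ᵐ y, y ∈ K → sturmExpr S.V f y = z * f y
  jump : ∀ n, S.x n ∈ K → JumpCondition (A n) f (S.x n)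

open Classical in
/-- The matrix that connects the one-sided limits at `p`: `A n` at `x n`, the identity
elsewhere. -/
noncomputable def transfer (S : SturmData) (A : S.idx → Matrix (Fin 2) (Fin 2) ℝ) (p : ℝ) :
    Matrix (Fin 2) (Fin 2) ℝ :=
  if h : ∃ n, S.x n = p then A h.choose else 1

theorem transfer_x (A : S.idx → Matrix (Fin 2) (Fin 2) ℝ) (n : S.idx) :
    S.transfer A (S.x n) = A n := by
  have h : ∃ m, S.x m = S.x n := ⟨n, rfl⟩
  rw [transfer, dif_pos h, S.x_injective h.choose_spec]

theorem transfer_of_notMem (A : S.idx → Matrix (Fin 2) (Fin 2) ℝ) {p : ℝ} (hp : p ∉ S.M) :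
    S.transfer A p = 1 := dif_neg hp

theorem det_transfer {A : S.idx → Matrix (Fin 2) (Fin 2) ℝ} (hA : ∀ n, (A n).det = 1) (p : ℝ) :
    (S.transfer A p).det = 1 := by
  rw [transfer]
  split_ifs
  · exact hA _
  · exact Matrix.det_one

theorem isOpen_sdiff_M {K : Set ℝ} (hK : IsOpen K) (hKJ : K ⊆ S.J) : IsOpen (K \ S.M) := by
  have : K \ S.M = K ∩ (S.J \ S.M) := by
    ext y; exact ⟨fun h => ⟨h.1, hKJ h.1, h.2⟩, fun h => ⟨h.1, h.2.2⟩⟩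
  rw [this]
  exact hK.inter S.isOpen_diff

theorem compl_M_mem_of_mem {p : ℝ} (hp : p ∈ S.J) : S.Mᶜ ∈ 𝓝[≠] p :=
  S.compl_M_mem (S.not_accPt p hp.1 hp.2)

/-- Around every point of an open set there is a punctured interval free of interaction points. -/
theorem exists_Ioo_subset {K : Set ℝ} (hK : IsOpen K) (hKJ : K ⊆ S.J) {p : ℝ} (hp : p ∈ K) :
    ∃ ε > 0, Ioo (p - ε) p ⊆ K \ S.M ∧ Ioo p (p + ε) ⊆ K \ S.M := by
  have h : K \ S.M ∈ 𝓝[≠] p :=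
    inter_mem (mem_nhdsWithin_of_mem_nhds (hK.mem_nhds hp)) (compl_M_mem_of_mem (hKJ hp))
  obtain ⟨ε, hε, hsub⟩ := Metric.mem_nhdsWithin_iff.1 h
  rw [Real.ball_eq_Ioo] at hsub
  refine ⟨ε, hε, fun y hy => hsub ⟨⟨hy.1, ?_⟩, hy.2.ne⟩, fun y hy => hsub ⟨⟨?_, hy.2⟩, hy.1.ne'⟩⟩
  · linarith [hy.2]
  · linarith [hy.1]

/-- Absolute continuity of the integral of the locally integrable function `1 + ‖V - z‖`. The bound
`1 / 4` is the one required by `LocallyAC₂.norm_add_norm_le`. -/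
theorem exists_small_integral {p : ℝ} (hp : p ∈ S.J) (z : ℂ) :
    ∃ ε > 0, ∀ c d, p - ε < c → c ≤ d → d < p + ε →
      IntervalIntegrable (fun y => (S.V y : ℂ) - z) volume c d ∧
      ∫ y in c..d, (1 + ‖(S.V y : ℂ) - z‖) ≤ 1 / 4 := by
  have h1 : IntegrableAtFilter S.V (𝓝 p) volume := by
    have : IntegrableAtFilter S.V (𝓝[S.J] p) volume := S.locallyIntegrable p hp
    rwa [IsOpen.nhdsWithin_eq S.isOpen_J hp] at this
  obtain ⟨s, hs, hVs⟩ := h1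
  obtain ⟨η, hη, hηs⟩ := Metric.nhds_basis_ball.mem_iff.1 hs
  have hVη : IntegrableOn (fun y => (S.V y : ℂ) - z) (Metric.ball p η) := by
    have h2 : IntegrableOn (fun y => (S.V y : ℂ)) (Metric.ball p η) := (hVs.mono_set hηs).ofReal
    exact h2.sub (integrableOn_const measure_ball_lt_top.ne)
  have hint : IntegrableOn (fun y => 1 + ‖(S.V y : ℂ) - z‖) (Metric.ball p η) :=
    (integrableOn_const measure_ball_lt_top.ne).add hVη.norm
  have hvol : Tendsto (fun ε : ℝ => (volume.restrict (Metric.ball p η)) (Ioo (p - ε) (p + ε)))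
      (𝓝[>] 0) (𝓝 0) := by
    have : Tendsto (fun ε : ℝ => volume (Ioo (p - ε) (p + ε))) (𝓝[>] 0) (𝓝 0) := by
      simp_rw [Real.volume_Ioo]
      have hc : Continuous fun ε : ℝ => ENNReal.ofReal (p + ε - (p - ε)) :=
        ENNReal.continuous_ofReal.comp (by fun_prop)
      have := (hc.tendsto 0).mono_left (nhdsWithin_le_nhds (s := Ioi 0))
      simpa using this
    exact tendsto_of_tendsto_of_tendsto_of_le_of_le tendsto_const_nhds this (fun _ => zero_le)
      fun _ => Measure.restrict_apply_le _ _
  have htend := Integrable.tendsto_setIntegral_nhds_zero hint hvol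
  have hev := (htend.eventually (gt_mem_nhds (show (0 : ℝ) < 1 / 4 by norm_num))).and
    ((Ioo_mem_nhdsGT hη))
  obtain ⟨ε, hsm, hε0, hεη⟩ := hev.exists
  refine ⟨ε, hε0, fun c d hc hcd hd => ?_⟩
  have hsub : Icc c d ⊆ Ioo (p - ε) (p + ε) := fun y hy => ⟨hc.trans_le hy.1, hy.2.trans_lt hd⟩
  have hball : Ioo (p - ε) (p + ε) ⊆ Metric.ball p η := by
    rw [Real.ball_eq_Ioo]; exact Ioo_subset_Ioo (by linarith) (by linarith)
  refine ⟨?_, ?_⟩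
  · rw [intervalIntegrable_iff_integrableOn_Icc_of_le hcd]
    exact hVη.mono_set (hsub.trans hball)
  · rw [intervalIntegral.integral_of_le hcd]
    refine le_trans ?_ hsm.le
    rw [Measure.restrict_restrict measurableSet_Ioo, inter_eq_left.2 hball]
    exact setIntegral_mono_set (hint.mono_set hball) (ae_of_all _ fun x => by
        show 0 ≤ 1 + ‖(S.V x : ℂ) - z‖; positivity)
      (LE.le.eventuallyLE (Ioc_subset_Icc_self.trans hsub))

namespace IsSolutionOn

variable {A : S.idx → Matrix (Fin 2) (Fin 2) ℝ} {z : ℂ} {K : Set ℝ} {f g : ℝ → ℂ}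

theorem deriv_deriv_eq (hf : S.IsSolutionOn A z K f) :
    ∀ᵐ y, y ∈ K \ S.M → deriv (deriv f) y = ((S.V y : ℂ) - z) * f y := by
  filter_upwards [hf.eqn] with y hy hyK
  have := hy hyK.1
  rw [sturmExpr] at this
  linear_combination -this

/-- One-sided limits of a solution exist at every point and are connected by the transfer
matrix. -/
theorem exists_limits (hf : S.IsSolutionOn A z K f) (hK : IsOpen K) (hKJ : K ⊆ S.J) {p : ℝ}
    (hp : p ∈ K) :
    ∃ l r : Fin 2 → ℂ,
      Tendsto f (𝓝[<] p) (𝓝 (l 0)) ∧ Tendsto (deriv f) (𝓝[<] p) (𝓝 (l 1)) ∧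
      Tendsto f (𝓝[>] p) (𝓝 (r 0)) ∧ Tendsto (deriv f) (𝓝[>] p) (𝓝 (r 1)) ∧
      r = ((S.transfer A p).map (fun t : ℝ => (t : ℂ))).mulVec l ∧
      (p ∉ S.M → f p = l 0 ∧ deriv f p = l 1) := by
  by_cases hM : p ∈ S.M
  · obtain ⟨n, rfl⟩ := hM
    obtain ⟨l, r, h1, h2, h3, h4, h5⟩ := hf.jump n hp
    exact ⟨l, r, h1, h2, h3, h4, by rw [transfer_x, h5], fun h => absurd ⟨n, rfl⟩ h⟩
  · have h1 := (hf.ac.1 p ⟨hp, hM⟩).continuousAt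
    have h2 := hf.ac.continuousAt_deriv (isOpen_sdiff_M hK hKJ) ⟨hp, hM⟩
    refine ⟨![f p, deriv f p], ![f p, deriv f p], h1.mono_left nhdsWithin_le_nhds,
      h2.mono_left nhdsWithin_le_nhds, h1.mono_left nhdsWithin_le_nhds,
      h2.mono_left nhdsWithin_le_nhds, ?_, fun _ => ⟨rfl, rfl⟩⟩
    rw [transfer_of_notMem A hM, Matrix.map_one _ (by simp) (by simp), Matrix.one_mulVec]

end IsSolutionOn

/-- In dimension two the Wronskian of the data is a determinant, so a matrix of determinant one
preserves it. This carries Wronskians across interaction points. -/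
theorem wronskian_mulVec (T : Matrix (Fin 2) (Fin 2) ℝ) (hT : T.det = 1) (l m : Fin 2 → ℂ) :
    (T.map (fun t : ℝ => (t : ℂ))).mulVec l 0 * (T.map (fun t : ℝ => (t : ℂ))).mulVec m 1 -
      (T.map (fun t : ℝ => (t : ℂ))).mulVec l 1 * (T.map (fun t : ℝ => (t : ℂ))).mulVec m 0 =
    l 0 * m 1 - l 1 * m 0 := by
  have hT' : (T 0 0 : ℂ) * T 1 1 - T 0 1 * T 1 0 = 1 := by
    rw [Matrix.det_fin_two] at hT
    exact_mod_cast hT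
  simp only [Matrix.mulVec, dotProduct, Fin.sum_univ_two, Matrix.map_apply]
  linear_combination (l 0 * m 1 - l 1 * m 0) * hT'

theorem mulVec_eq_zero_iff_of_det_eq_one {T : Matrix (Fin 2) (Fin 2) ℝ} (hT : T.det = 1)
    {l : Fin 2 → ℂ} : (T.map (fun t : ℝ => (t : ℂ))).mulVec l = 0 ↔ l = 0 := by
  have hd : (T.map (fun t : ℝ => (t : ℂ))).det ≠ 0 := by
    have : (T.map (fun t : ℝ => (t : ℂ))).det = ((T.det : ℝ) : ℂ) :=
      (RingHom.map_det Complex.ofRealHom T).symm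
    rw [this, hT]; simp
  exact ⟨Matrix.eq_zero_of_mulVec_eq_zero hd, fun h => by rw [h, Matrix.mulVec_zero]⟩

theorem tendsto_wronskian {f g : ℝ → ℂ} {F : Filter ℝ} {a b c d : ℂ} (h1 : Tendsto f F (𝓝 a))
    (h2 : Tendsto (deriv f) F (𝓝 b)) (h3 : Tendsto g F (𝓝 c)) (h4 : Tendsto (deriv g) F (𝓝 d)) :
    Tendsto (wronskian f g) F (𝓝 (a * d - b * c)) :=
  (h1.mul h4).sub (h2.mul h3)

namespace IsSolutionOn

variable {A : S.idx → Matrix (Fin 2) (Fin 2) ℝ} {z : ℂ} {K : Set ℝ} {f g : ℝ → ℂ}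

/-- The Wronskian is constant on a punctured interval on either side of `p`, equal there to its
one-sided limit; the two limits agree because the transfer matrix has determinant one. -/
theorem wronskian_locally_eq (hA : ∀ n, (A n).det = 1) (hf : S.IsSolutionOn A z K f)
    (hg : S.IsSolutionOn A z K g) (hK : IsOpen K) (hKJ : K ⊆ S.J) {p : ℝ} (hp : p ∈ K) :
    ∃ k, ∀ᶠ y in 𝓝 p, y ∉ S.M → wronskian f g y = k := by
  obtain ⟨l, r, h1, h2, h3, h4, h5, h6⟩ := hf.exists_limits hK hKJ hp
  obtain ⟨l', r', h1', h2', h3', h4', h5', h6'⟩ := hg.exists_limits hK hKJ hp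
  have hL := tendsto_wronskian h1 h2 h1' h2'
  have hR := tendsto_wronskian h3 h4 h3' h4'
  rw [h5, h5', wronskian_mulVec _ (det_transfer hA p)] at hR
  obtain ⟨ε, hε, hsl, hsr⟩ := exists_Ioo_subset hK hKJ hp
  have hU := isOpen_sdiff_M hK hKJ
  have hW : ∀ c d, c ≤ d → Icc c d ⊆ K \ S.M → wronskian f g c = wronskian f g d :=
    fun c d hcd hs => hf.ac.wronskian_eq hg.ac hU hf.deriv_deriv_eq hg.deriv_deriv_eq hcd hs
  refine ⟨l 0 * l' 1 - l 1 * l' 0, ?_⟩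
  filter_upwards [Ioo_mem_nhds (show p - ε < p by linarith) (show p < p + ε by linarith)]
    with y hy hyM
  rcases lt_trichotomy y p with h | h | h
  · refine tendsto_nhds_unique_of_eventuallyEq tendsto_const_nhds hL ?_
    filter_upwards [Ioo_mem_nhdsLT h] with w hw
    exact hW y w hw.1.le fun x hx => hsl ⟨hy.1.trans_le hx.1, hx.2.trans_lt hw.2⟩
  · subst h
    rw [wronskian, (h6 hyM).1, (h6 hyM).2, (h6' hyM).1, (h6' hyM).2]
  · refine tendsto_nhds_unique_of_eventuallyEq tendsto_const_nhds hR ?_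
    filter_upwards [Ioo_mem_nhdsGT h] with w hw
    exact (hW w y hw.2.le fun x hx => hsr ⟨hw.1.trans_le hx.1, hx.2.trans_lt hy.2⟩).symm

theorem wronskian_eq (hA : ∀ n, (A n).det = 1) (hf : S.IsSolutionOn A z K f)
    (hg : S.IsSolutionOn A z K g) (hK : IsOpen K) (hKJ : K ⊆ S.J) (hKc : IsPreconnected K)
    {c d : ℝ} (hc : c ∈ K \ S.M) (hd : d ∈ K \ S.M) : wronskian f g c = wronskian f g d :=
  hKc.eq_of_locally_eq_off (fun _ hp => compl_M_mem_of_mem (hKJ hp))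
    (fun _ hp => hf.wronskian_locally_eq hA hg hK hKJ hp) hc.1 hd.1 hc.2 hd.2

/-- Local uniqueness for the Cauchy problem, with a right-hand side independent of `y` so that it
propagates along `K`. If the left limits vanish, so do the right ones, and the stability estimate in
the limit at `p` forces zero data on both sides. If they do not, neither do the right limits, the
transfer matrix being invertible, and the data are nonzero near `p`. -/
theorem eventually_eq_zero_iff (hA : ∀ n, (A n).det = 1) (hf : S.IsSolutionOn A z K f) (hK : IsOpen K)
    (hKJ : K ⊆ S.J) {p : ℝ} (hp : p ∈ K) :
    ∀ᶠ y in 𝓝 p, y ∉ S.M → (‖f y‖ + ‖deriv f y‖ = 0 ↔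
      Tendsto f (𝓝[<] p) (𝓝 0) ∧ Tendsto (deriv f) (𝓝[<] p) (𝓝 0)) := by
  obtain ⟨l, r, h1, h2, h3, h4, h5, h6⟩ := hf.exists_limits hK hKJ hp
  have hlr : r = 0 ↔ l = 0 := by rw [h5, mulVec_eq_zero_iff_of_det_eq_one (det_transfer hA p)]
  have hnorm : ∀ v : Fin 2 → ℂ, ‖v 0‖ + ‖v 1‖ = 0 ↔ v = 0 := by
    intro v
    rw [add_eq_zero_iff_of_nonneg (norm_nonneg _) (norm_nonneg _), norm_eq_zero, norm_eq_zero,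
      funext_iff, Fin.forall_fin_two]
    rfl
  have hL := h1.norm.add h2.norm
  have hR := h3.norm.add h4.norm
  have hlim : (Tendsto f (𝓝[<] p) (𝓝 0) ∧ Tendsto (deriv f) (𝓝[<] p) (𝓝 0)) ↔ l = 0 := by
    rw [funext_iff, Fin.forall_fin_two]
    refine ⟨fun h => ⟨tendsto_nhds_unique h1 h.1, tendsto_nhds_unique h2 h.2⟩, fun h => ?_⟩
    exact ⟨by simpa [h.1] using h1, by simpa [h.2] using h2⟩
  rw [hlim]
  by_cases hl : l = 0
  · obtain ⟨ε, hε, hsl, hsr⟩ := exists_Ioo_subset hK hKJ hp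
    obtain ⟨δ, hδ, hsm⟩ := exists_small_integral (hKJ hp) z
    rw [(hnorm l).2 hl] at hL
    rw [(hnorm r).2 (hlr.2 hl)] at hR
    have hm1 := min_le_left ε δ
    have hm2 := min_le_right ε δ
    have hm0 : 0 < min ε δ := lt_min hε hδ
    have hle : ∀ c d, c ≤ d → p - min ε δ < c → d < p + min ε δ → Icc c d ⊆ K \ S.M →
        ∀ s ∈ Icc c d, ∀ t ∈ Icc c d,
          ‖f t‖ + ‖deriv f t‖ ≤ 2 * (‖f s‖ + ‖deriv f s‖) := by
      intro c d hcd hc hd hs s hss t ht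
      obtain ⟨e1, e2⟩ := hsm c d (by linarith) hcd (by linarith)
      exact hf.ac.norm_add_norm_le hf.deriv_deriv_eq hcd hs e1 e2 hss ht
    filter_upwards [Ioo_mem_nhds (show p - min ε δ < p by linarith)
      (show p < p + min ε δ by linarith)] with y hy hyM
    refine iff_of_true ?_ hl
    refine le_antisymm ?_ (by positivity)
    rcases lt_trichotomy y p with h | h | h
    · have := hL.const_mul 2
      rw [mul_zero] at this
      refine ge_of_tendsto this ?_
      filter_upwards [Ioo_mem_nhdsLT h] with w hw
      exact hle y w hw.1.le hy.1 (by linarith [hw.2])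
        (fun x hx => hsl ⟨by linarith [hy.1, hx.1], hx.2.trans_lt hw.2⟩) w
        (right_mem_Icc.2 hw.1.le) y (left_mem_Icc.2 hw.1.le)
    · subst h
      rw [(h6 hyM).1, (h6 hyM).2, (hnorm l).2 hl]
    · have := hR.const_mul 2
      rw [mul_zero] at this
      refine ge_of_tendsto this ?_
      filter_upwards [Ioo_mem_nhdsGT h] with w hw
      exact hle w y hw.2.le (by linarith [hw.1]) hy.2
        (fun x hx => hsr ⟨hw.1.trans_le hx.1, by linarith [hy.2, hx.2]⟩) w
        (left_mem_Icc.2 hw.2.le) y (right_mem_Icc.2 hw.2.le)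
  · have eL := hL.eventually_ne (mt (hnorm l).1 hl)
    have eR := hR.eventually_ne (mt (hnorm r).1 (mt hlr.1 hl))
    rw [eventually_nhdsWithin_iff] at eL eR
    filter_upwards [eL, eR] with y hy1 hy2 hyM
    refine iff_of_false ?_ hl
    rcases lt_trichotomy y p with h | h | h
    · exact hy1 h
    · subst h
      rw [(h6 hyM).1, (h6 hyM).2]
      exact mt (hnorm l).1 hl
    · exact hy2 h

/-- A solution whose left limits vanish at one point vanishes off the interaction points. -/
theorem eq_zero_of_tendsto (hA : ∀ n, (A n).det = 1) (hf : S.IsSolutionOn A z K f)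
    (hK : IsOpen K) (hKJ : K ⊆ S.J) (hKc : IsPreconnected K) {p : ℝ} (hp : p ∈ K)
    (h0 : Tendsto f (𝓝[<] p) (𝓝 0)) (h1 : Tendsto (deriv f) (𝓝[<] p) (𝓝 0)) {y : ℝ}
    (hy : y ∈ K \ S.M) : f y = 0 := by
  obtain ⟨w, hw, hwz⟩ := ((eventually_mem_set.2 (inter_mem (mem_nhdsWithin_of_mem_nhds
    (hK.mem_nhds hp)) (compl_M_mem_of_mem (hKJ hp)))).and
    ((hf.eventually_eq_zero_iff hA hK hKJ hp).filter_mono nhdsWithin_le_nhds)).exists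
  have hz : ‖f w‖ + ‖deriv f w‖ = 0 := (hwz hw.2).2 ⟨h0, h1⟩
  -- Vanishing of the Cauchy data, viewed as a proposition-valued function, is locally constant off
  -- the interaction points.
  have hW : (‖f w‖ + ‖deriv f w‖ = 0) = (‖f y‖ + ‖deriv f y‖ = 0) :=
    hKc.eq_of_locally_eq_off (W := fun w => ‖f w‖ + ‖deriv f w‖ = 0)
      (fun _ hp => compl_M_mem_of_mem (hKJ hp))
      (fun _ hp => ⟨_, (hf.eventually_eq_zero_iff hA hK hKJ hp).mono
        fun _ h hM => propext (h hM)⟩) hw.1 hy.1 hw.2 hy.2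
  rw [hW] at hz
  exact norm_le_zero_iff.1 (by linarith [norm_nonneg (f y), norm_nonneg (deriv f y)])

end IsSolutionOn

end SturmData

/-! ### Resampling one coordinate of a product measure -/

namespace MeasureTheory.Measure

/-- Resampling one coordinate leaves an infinite product measure invariant. -/
theorem map_update_infinitePi {ι : Type*} [DecidableEq ι] {X : ι → Type*}
    [∀ i, MeasurableSpace (X i)] (q : ∀ i, Measure (X i)) [∀ i, IsProbabilityMeasure (q i)]
    (i₀ : ι) :
    ((infinitePi q).prod (q i₀)).map (fun p => Function.update p.1 i₀ p.2) = infinitePi q := by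
  refine eq_infinitePi q fun s t ht => ?_
  rw [map_apply measurable_update' (.pi s.countable_toSet fun i _ => ht i)]
  by_cases hs : i₀ ∈ s
  -- The update discards the old coordinate `i₀`, so the preimage of a box constrains the old point
  -- only off `i₀`; the resampled coordinate supplies the missing factor.
  · have : (fun p : (∀ i, X i) × X i₀ => Function.update p.1 i₀ p.2) ⁻¹' (Set.pi s t) =
        (Set.pi (s.erase i₀) t) ×ˢ (t i₀) := by
      ext p
      simp only [mem_preimage, Set.mem_pi, mem_prod, Finset.mem_coe, Finset.mem_erase]
      refine ⟨fun h => ⟨fun i hi => ?_, ?_⟩, fun h i hi => ?_⟩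
      · simpa [hi.1] using h i hi.2
      · simpa using h i₀ hs
      · by_cases hi' : i = i₀
        · subst hi'; simpa using h.2
        · simpa [hi'] using h.1 i ⟨hi', hi⟩
    rw [this, prod_prod, infinitePi_pi q fun i _ => ht i, Finset.prod_erase_mul _ _ hs]
  · have : (fun p : (∀ i, X i) × X i₀ => Function.update p.1 i₀ p.2) ⁻¹' (Set.pi s t) =
        (Set.pi s t) ×ˢ univ := by
      ext p
      simp only [mem_preimage, Set.mem_pi, mem_prod, Finset.mem_coe, mem_univ, and_true]
      refine forall₂_congr fun i hi => ?_
      rw [Function.update_of_ne (ne_of_mem_of_not_mem hi hs)]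
    rw [this, prod_prod, infinitePi_pi q fun i _ => ht i, measure_univ, mul_one]

/-- A null measurable set whose sections in one coordinate are null is null. -/
theorem infinitePi_null_of_update_null {ι : Type*} [DecidableEq ι] {X : ι → Type*}
    [∀ i, MeasurableSpace (X i)] (q : ∀ i, Measure (X i)) [∀ i, IsProbabilityMeasure (q i)]
    (i₀ : ι) {B : Set (∀ i, X i)} (hB : NullMeasurableSet B (infinitePi q))
    (h : ∀ ω, q i₀ {t | Function.update ω i₀ t ∈ B} = 0) : infinitePi q B = 0 := by
  -- A measurable subset of full measure has sections inside those of `B`, so Fubini needs no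
  -- measurability of `B` itself.
  obtain ⟨C, hCB, hC, hCeq⟩ := hB.exists_measurable_subset_ae_eq
  rw [← measure_congr hCeq, ← map_update_infinitePi q i₀, map_apply measurable_update' hC,
    measure_prod_null (measurable_update' hC)]
  exact ae_of_all _ fun ω => measure_mono_null (fun t ht => hCB ht) (h ω)

end MeasureTheory.Measure

/-! ### Linear algebra of the interaction matrices -/

theorem countable_sin_sub_eq_zero (s : ℝ) : {t : ℝ | Real.sin (t - s) = 0}.Countable := by
  refine (countable_range fun n : ℤ => n * Real.pi + s).mono fun t ht => ?_
  obtain ⟨n, hn⟩ := Real.sin_eq_zero_iff.1 ht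
  exact ⟨n, by simp only [hn]; ring⟩

theorem det_interactionMatrix (α θ : ℝ) {r : ℝ} (hr : r ≠ 0) :
    (interactionMatrix α r θ).det = 1 := by
  simp only [interactionMatrix, Matrix.det_mul, parabolicMatrix, hyperbolicMatrix, ellipticMatrix,
    Matrix.det_fin_two_of]
  field_simp
  linear_combination Real.sin_sq_add_cos_sq θ

/-- The common factor `P_α H_r` has determinant one and drops out; what remains is the determinant
of `l` and of `m` rotated by `s - θ`. The product next to the sine is bilinear, not Hermitian, hence
the later use with a conjugated vector. -/
theorem wronskian_interactionMatrix (α θ s : ℝ) {r : ℝ} (hr : r ≠ 0) (l m : Fin 2 → ℂ) :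
    ((interactionMatrix α r θ).map (fun t : ℝ => (t : ℂ))).mulVec l 0 *
        ((interactionMatrix α r s).map (fun t : ℝ => (t : ℂ))).mulVec m 1 -
      ((interactionMatrix α r θ).map (fun t : ℝ => (t : ℂ))).mulVec l 1 *
        ((interactionMatrix α r s).map (fun t : ℝ => (t : ℂ))).mulVec m 0 =
    (Real.cos (s - θ) : ℂ) * (l 0 * m 1 - l 1 * m 0) +
      (Real.sin (s - θ) : ℂ) * (l 0 * m 0 + l 1 * m 1) := by
  have hr' : (r : ℂ) ≠ 0 := by exact_mod_cast hr
  rw [Real.cos_sub, Real.sin_sub]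
  simp only [interactionMatrix, parabolicMatrix, hyperbolicMatrix, ellipticMatrix,
    Matrix.mulVec, dotProduct, Fin.sum_univ_two, Matrix.map_apply, Matrix.mul_apply,
    Matrix.of_apply, Matrix.cons_val', Matrix.cons_val_zero, Matrix.cons_val_one,
    Matrix.cons_val_fin_one]
  push_cast
  field_simp
  ring

/-- Two parallel real directions are mapped to parallel directions by two Iwasawa products that
differ in the angle only if the angles agree modulo `π`. -/
theorem sin_sub_eq_zero_of_parallel (α θ s : ℝ) {r : ℝ} (hr : r ≠ 0) {l m : Fin 2 → ℂ}
    (hl : l ≠ 0) (hm : m ≠ 0) (h1 : l 0 * m 1 - l 1 * m 0 = 0)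
    (h2 : l 0 * star (m 1) - l 1 * star (m 0) = 0)
    (h3 : ((interactionMatrix α r θ).map (fun t : ℝ => (t : ℂ))).mulVec l 0 *
        ((interactionMatrix α r s).map (fun t : ℝ => (t : ℂ))).mulVec (star m) 1 -
      ((interactionMatrix α r θ).map (fun t : ℝ => (t : ℂ))).mulVec l 1 *
        ((interactionMatrix α r s).map (fun t : ℝ => (t : ℂ))).mulVec (star m) 0 = 0) :
    Real.sin (s - θ) = 0 := by
  rw [wronskian_interactionMatrix α θ s hr] at h3
  simp only [Pi.star_apply] at h3
  rw [h2, mul_zero, zero_add, mul_eq_zero] at h3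
  rcases h3 with h3 | h3
  · exact_mod_cast h3
  -- Now `l` is Hermitian-orthogonal to `m`, while `h1` says that they are parallel. Together these
  -- make `‖m 0‖ ^ 2 + ‖m 1‖ ^ 2` annihilate both entries of `l`, which is impossible.
  exfalso
  have hN : m 0 * star (m 0) + m 1 * star (m 1) ≠ 0 := by
    have e : m 0 * star (m 0) + m 1 * star (m 1) = ((‖m 0‖ ^ 2 + ‖m 1‖ ^ 2 : ℝ) : ℂ) := by
      push_cast
      rw [← Complex.mul_conj', ← Complex.mul_conj']
      rfl
    rw [e]
    norm_cast
    intro h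
    refine hm (funext fun i => ?_)
    have h0 : ‖m 0‖ = 0 := by nlinarith [norm_nonneg (m 0), sq_nonneg ‖m 1‖]
    have h1 : ‖m 1‖ = 0 := by nlinarith [norm_nonneg (m 1), sq_nonneg ‖m 0‖]
    fin_cases i
    · exact norm_eq_zero.1 h0
    · exact norm_eq_zero.1 h1
  have e0 : l 0 * (m 0 * star (m 0) + m 1 * star (m 1)) = 0 := by
    linear_combination m 0 * h3 + star (m 1) * h1
  have e1 : l 1 * (m 0 * star (m 0) + m 1 * star (m 1)) = 0 := by
    linear_combination m 1 * h3 - star (m 0) * h1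
  refine hl (funext fun i => ?_)
  fin_cases i
  · exact (mul_eq_zero.1 e0).resolve_right hN
  · exact (mul_eq_zero.1 e1).resolve_right hN

/-! ### Complex conjugation and boundary conditions -/

theorem Matrix.star_mulVec_map_ofReal (A : Matrix (Fin 2) (Fin 2) ℝ) (l : Fin 2 → ℂ) :
    star ((A.map (fun t : ℝ => (t : ℂ))).mulVec l) =
      (A.map (fun t : ℝ => (t : ℂ))).mulVec (star l) := by
  ext i
  simp only [Matrix.mulVec, dotProduct, Fin.sum_univ_two, Matrix.map_apply, Pi.star_apply,
    star_add, star_mul', Complex.star_def, Complex.conj_ofReal]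

theorem JumpCondition.star {A : Matrix (Fin 2) (Fin 2) ℝ} {f : ℝ → ℂ} {p : ℝ}
    (hf : JumpCondition A f p) : JumpCondition A (fun y => star (f y)) p := by
  obtain ⟨l, r, h1, h2, h3, h4, h5⟩ := hf
  refine ⟨Star.star l, Star.star r, h1.star, ?_, h3.star, ?_, ?_⟩
  · rw [deriv.star']; exact h2.star
  · rw [deriv.star']; exact h4.star
  · rw [h5, Matrix.star_mulVec_map_ofReal]

theorem SturmData.BoundaryCondition.star {ψ : ℝ} {f : ℝ → ℂ} {F : Filter ℝ}
    (hf : BoundaryCondition ψ f F) : BoundaryCondition ψ (fun y => star (f y)) F := by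
  obtain ⟨p, p', h1, h2, h3⟩ := hf
  refine ⟨Star.star p, Star.star p', h1.star, ?_, ?_⟩
  · rw [deriv.star']; exact h2.star
  · have := congrArg Star.star h3
    simpa [-Complex.ofReal_cos, -Complex.ofReal_sin] using this

/-- Both pairs of boundary values lie in the kernel of the nonzero row `(cos ψ, sin ψ)`, which is
one-dimensional, so their determinant is zero. -/
theorem SturmData.BoundaryCondition.wronskian_eq_zero {ψ : ℝ} {f g : ℝ → ℂ} {F : Filter ℝ}
    (hf : BoundaryCondition ψ f F) (hg : BoundaryCondition ψ g F) :
    Tendsto (wronskian f g) F (𝓝 0) := by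
  obtain ⟨p, p', h1, h2, h3⟩ := hf
  obtain ⟨q, q', k1, k2, k3⟩ := hg
  have h := SturmData.tendsto_wronskian h1 h2 k1 k2
  have e : p * q' - p' * q = 0 := by
    have hcs : (Real.cos ψ : ℂ) ^ 2 + (Real.sin ψ : ℂ) ^ 2 = 1 := by
      exact_mod_cast Real.cos_sq_add_sin_sq ψ
    linear_combination (-(p * q' - p' * q)) * hcs +
      ((Real.cos ψ : ℂ) * q' - (Real.sin ψ : ℂ) * q) * h3 -
      ((Real.cos ψ : ℂ) * p' - (Real.sin ψ : ℂ) * p) * k3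
  rwa [e] at h

/-! ### Eigenfunctions and the comparison of two angles -/

namespace SturmData

variable {S : SturmData}

namespace IsSolutionOn

variable {A : S.idx → Matrix (Fin 2) (Fin 2) ℝ} {z : ℂ} {K : Set ℝ} {f g : ℝ → ℂ}

theorem mono {A' : S.idx → Matrix (Fin 2) (Fin 2) ℝ} {K' : Set ℝ} (hf : S.IsSolutionOn A z K f)
    (h : K' ⊆ K) (hA : ∀ n, S.x n ∈ K' → A n = A' n) : S.IsSolutionOn A' z K' f :=
  ⟨hf.ac.mono (sdiff_subset_sdiff_left h), hf.eqn.mono fun _ hy hyK => hy (h hyK),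
    fun n hn => hA n hn ▸ hf.jump n (h hn)⟩

/-- Conjugation preserves the problem because the spectral parameter, the potential and the matrices
are real. -/
theorem star {E : ℝ} (hf : S.IsSolutionOn A E K f) :
    S.IsSolutionOn A E K (fun y => star (f y)) := by
  refine ⟨hf.ac.star, hf.eqn.mono fun y hy hyK => ?_, fun n hn => (hf.jump n hn).star⟩
  have := congrArg Star.star (hy hyK)
  simp only [sturmExpr] at this ⊢
  rw [deriv.star', deriv.star]
  simpa using this

/-- The Wronskian of two square integrable solutions vanishes if both satisfy the same
boundary condition, or if some solution is not square integrable. -/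
theorem wronskian_eq_zero (hA : ∀ n, (A n).det = 1) (hf : S.IsSolutionOn A z K f)
    (hg : S.IsSolutionOn A z K g) (hK : IsOpen K) (hKJ : K ⊆ S.J) (hKc : IsPreconnected K)
    (hf2 : MemLp f 2 (volume.restrict K)) (hg2 : MemLp g 2 (volume.restrict K))
    (h : (∃ (F : Filter ℝ) (ψ : ℝ), F.NeBot ∧ K \ S.M ∈ F ∧
        BoundaryCondition ψ f F ∧ BoundaryCondition ψ g F) ∨
      ∃ u, S.IsSolutionOn A z K u ∧ ¬ MemLp u 2 (volume.restrict K))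
    {y : ℝ} (hy : y ∈ K \ S.M) : wronskian f g y = 0 := by
  rcases h with ⟨F, ψ, hF, hKF, hbf, hbg⟩ | ⟨u, hu, hu2⟩
  · refine tendsto_nhds_unique_of_eventuallyEq tendsto_const_nhds (hbf.wronskian_eq_zero hbg) ?_
    filter_upwards [hKF] with w hw
    exact hf.wronskian_eq hA hg hK hKJ hKc hy hw
  -- If `W ≠ 0`, Cramer's rule writes `u` as a combination of `f` and `g` whose coefficients are
  -- quotients of Wronskians, hence constant; `u` would be square integrable.
  · by_contra hne
    refine hu2 ?_
    set W := wronskian f g y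
    have hcomb : MemLp ((wronskian u g y / W) • f + (wronskian f u y / W) • g) 2
        (volume.restrict K) := (hf2.const_smul _).add (hg2.const_smul _)
    refine hcomb.ae_eq ?_
    have hM : ∀ᵐ w ∂volume.restrict K, w ∉ S.M :=
      ae_restrict_of_ae ((countable_range S.x).ae_notMem volume)
    filter_upwards [hM, ae_restrict_mem hK.measurableSet] with w hwM hwK
    have hw : w ∈ K \ S.M := ⟨hwK, hwM⟩
    simp only [Pi.add_apply, Pi.smul_apply, smul_eq_mul]
    rw [hu.wronskian_eq hA hg hK hKJ hKc hy hw, hf.wronskian_eq hA hu hK hKJ hKc hy hw]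
    have hWw : W = wronskian f g w := hf.wronskian_eq hA hg hK hKJ hKc hy hw
    rw [div_mul_eq_mul_div, div_mul_eq_mul_div, ← add_div, div_eq_iff hne, hWw]
    simp only [wronskian]
    ring

end IsSolutionOn

theorem ordConnected_J (S : SturmData) : S.J.OrdConnected :=
  ⟨fun _ hx _ hy _ hw => ⟨hx.1.trans_le (by exact_mod_cast hw.1),
    lt_of_le_of_lt (by exact_mod_cast hw.2) hy.2⟩⟩

theorem IsSolution.isSolutionOn {Λ R Θ : S.idx → ℝ} {z : ℂ} {f : ℝ → ℂ}
    (hf : S.IsSolution Λ R Θ z 0 f) :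
    S.IsSolutionOn (fun n => interactionMatrix (Λ n) (R n) (Θ n)) z S.J f := by
  refine ⟨hf.ac, ?_, fun n _ => hf.jump n⟩
  have := hf.eqn
  rw [μ, ae_restrict_iff' S.isOpen_J.measurableSet] at this
  filter_upwards [this] with y hy hyJ
  exact sub_eq_zero.1 (hy hyJ)

/-- An eigenvalue has an eigenfunction in the pointwise sense. -/
theorem exists_isSolutionOn_of_mem_pointSpectrum {ψa ψb : ℝ} {Λ R Θ : S.idx → ℝ} {z : ℂ}
    (h : z ∈ pointSpectrum (S.hamiltonian ψa ψb Λ R Θ)) :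
    ∃ f, S.InDomain ψa ψb Λ R Θ f ∧
      S.IsSolutionOn (fun n => interactionMatrix (Λ n) (R n) (Θ n)) z S.J f ∧
      ∃ y ∈ S.J \ S.M, f y ≠ 0 := by
  obtain ⟨φ, hφ, hz⟩ := h
  have hd := S.rep_inDomain ψa ψb Λ R Θ φ
  have hrep := S.coe_ae_eq_rep ψa ψb Λ R Θ φ
  refine ⟨_, hd, IsSolution.isSolutionOn ⟨hd.max.ac, ?_, hd.max.jump⟩, ?_⟩
  · have h1 := S.hamiltonian_ae_eq ψa ψb Λ R Θ φ hd hrep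
    rw [hz] at h1
    filter_upwards [h1, hrep, Lp.coeFn_smul z (φ : S.L2)] with y h1 h2 h3
    rw [← h1, h3, Pi.smul_apply, h2, smul_eq_mul, sub_self, Pi.zero_apply]
  · by_contra! hne
    refine hφ (Subtype.ext (Lp.ext ?_))
    refine hrep.trans ?_
    filter_upwards [S.ae_mem_diff, Lp.coeFn_zero ℂ 2 S.μ] with y hy h0
    rw [hne y hy]
    exact h0.symm

/-- Changing the angle at a single point, a given real number is an eigenvalue only if the angles
agree modulo `π`. -/
theorem sin_sub_eq_zero_of_mem_pointSpectrum {ψa ψb : ℝ} {Λ R Θ Θ' : S.idx → ℝ}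
    (hR : ∀ n, 0 < R n) (hleft : S.LimitPointLeft Λ R Θ ∨ S.RegularLeft)
    (hright : S.LimitPointRight Λ R Θ ∨ S.RegularRight) {E : ℝ} {n₀ : S.idx}
    (hΘ : ∀ n, n ≠ n₀ → Θ n = Θ' n)
    (h : (E : ℂ) ∈ pointSpectrum (S.hamiltonian ψa ψb Λ R Θ))
    (h' : (E : ℂ) ∈ pointSpectrum (S.hamiltonian ψa ψb Λ R Θ')) :
    Real.sin (Θ' n₀ - Θ n₀) = 0 := by
  obtain ⟨f, hfd, hf, y, hy, hfy⟩ := exists_isSolutionOn_of_mem_pointSpectrum h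
  obtain ⟨g, hgd, hg, y', hy', hgy⟩ := exists_isSolutionOn_of_mem_pointSpectrum h'
  set A : S.idx → Matrix (Fin 2) (Fin 2) ℝ := fun n => interactionMatrix (Λ n) (R n) (Θ n) with hAd
  set A' : S.idx → Matrix (Fin 2) (Fin 2) ℝ := fun n => interactionMatrix (Λ n) (R n) (Θ' n)
    with hA'd
  have hA : ∀ n, (A n).det = 1 := fun n => det_interactionMatrix _ _ (hR n).ne'
  have hA' : ∀ n, (A' n).det = 1 := fun n => det_interactionMatrix _ _ (hR n).ne'
  have hJ := S.isOpen_J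
  have hp : S.x n₀ ∈ S.J := S.x_mem n₀
  set p := S.x n₀ with hpd
  -- Away from `p` the two families of matrices agree, so on each side `g` solves the same problem
  -- as `f`.
  have hAA : ∀ K : Set ℝ, p ∉ K → ∀ n, S.x n ∈ K → A' n = A n := by
    intro K hpK n hn
    have : n ≠ n₀ := fun e => hpK (by rw [hpd, ← e]; exact hn)
    simp only [hAd, hA'd, hΘ n this]
  obtain ⟨l, r, hl0, hl1, hr0, hr1, hlr, -⟩ := hf.exists_limits hJ subset_rfl hp
  obtain ⟨l', r', hl0', hl1', hr0', hr1', hlr', -⟩ := hg.exists_limits hJ subset_rfl hp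
  rw [hpd, transfer_x] at hlr hlr'
  have hstar : ∀ {F : Filter ℝ} {c : ℂ}, Tendsto (deriv g) F (𝓝 c) →
      Tendsto (deriv fun y => star (g y)) F (𝓝 (star c)) := by
    intro F c hc
    rw [deriv.star']; exact hc.star
  -- Zero Cauchy data at `p-` would make the eigenfunction vanish off the interaction points.
  have hl : l ≠ 0 := by
    rintro rfl
    exact hfy (hf.eq_zero_of_tendsto hA hJ subset_rfl S.ordConnected_J.isPreconnected hp hl0 hl1
      hy)
  have hl' : l' ≠ 0 := by
    rintro rfl
    exact hgy (hg.eq_zero_of_tendsto hA' hJ subset_rfl S.ordConnected_J.isPreconnected hp hl0' hl1'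
      hy')
  have hf2 := hfd.max.memLp
  have hg2 := hgd.max.memLp
  have hgs2 : MemLp (fun y => star (g y)) 2 S.μ := hg2.star
  -- the left of `p`
  have hLo : IsOpen (S.J ∩ Iio p) := hJ.inter isOpen_Iio
  have hLc : IsPreconnected (S.J ∩ Iio p) :=
    (S.ordConnected_J.inter ordConnected_Iio).isPreconnected
  have hLJ : S.J ∩ Iio p ⊆ S.J := inter_subset_left
  have hLμ : volume.restrict (S.J ∩ Iio p) ≤ S.μ := Measure.restrict_mono hLJ le_rfl
  have hfL := hf.mono hLJ (A' := A) fun _ _ => rfl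
  have hgL := hg.mono hLJ (hAA _ fun h => lt_irrefl p h.2)
  -- Stated for general `v` since it serves twice, for `g` and for its conjugate.
  have hLend : ∀ v, MemLp v 2 S.μ → S.IsSolutionOn A E (S.J ∩ Iio p) v →
      (∀ a₀, S.RegularLeftAt a₀ → BoundaryCondition ψa v (𝓝[>] a₀)) →
      ∀ w ∈ (S.J ∩ Iio p) \ S.M, wronskian f v w = 0 := by
    intro v hv2 hv hvb w hw
    refine hfL.wronskian_eq_zero hA hv hLo hLJ hLc (hf2.mono_measure hLμ) (hv2.mono_measure hLμ)
      ?_ hw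
    rcases hleft with hlp | ⟨a₀, ha⟩
    · obtain ⟨u, hu, hu2⟩ := hlp E
      -- Square integrability on all of `(a, p)` would be square integrability near `a`, with `p` as
      -- the cut.
      exact Or.inr ⟨u, hu.isSolutionOn.mono hLJ fun _ _ => rfl, fun h => hu2 ⟨p, hp, h⟩⟩
    · refine Or.inl ⟨𝓝[>] a₀, ψa, inferInstance, ?_, hfd.left a₀ ha, hvb a₀ ha⟩
      have hap : a₀ < p := by have := hp.1; rw [ha.eq] at this; exact_mod_cast this
      filter_upwards [ha.mem, mem_nhdsWithin_of_mem_nhds (Iio_mem_nhds hap)] with x h1 h2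
      exact ⟨⟨h1.1, h2⟩, h1.2⟩
  have hLmem : ∀ᶠ w in 𝓝[<] p, w ∈ (S.J ∩ Iio p) \ S.M := by
    filter_upwards [nhdsWithin_mono p (fun y hy => ne_of_lt hy) (S.diff_mem_punctured hp),
      self_mem_nhdsWithin] with w h1 h2
    exact ⟨⟨h1.1, h2⟩, h1.2⟩
  have h1 : l 0 * l' 1 - l 1 * l' 0 = 0 :=
    tendsto_nhds_unique_of_eventuallyEq (tendsto_wronskian hl0 hl1 hl0' hl1') tendsto_const_nhds
      (hLmem.mono fun w hw => hLend g hg2 hgL hgd.left w hw)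
  -- This kills the cosine term at `p`, while `h1` keeps the Hermitian product of `l` and `l'` away
  -- from zero. On the right, one relation with the conjugate of `g` is enough.
  have h2 : l 0 * star (l' 1) - l 1 * star (l' 0) = 0 :=
    tendsto_nhds_unique_of_eventuallyEq
      (tendsto_wronskian hl0 hl1 hl0'.star (hstar hl1')) tendsto_const_nhds
      (hLmem.mono fun w hw => hLend _ hgs2 hgL.star (fun a₀ ha => (hgd.left a₀ ha).star) w hw)
  -- the right of `p`
  have hRo : IsOpen (S.J ∩ Ioi p) := hJ.inter isOpen_Ioi
  have hRc : IsPreconnected (S.J ∩ Ioi p) :=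
    (S.ordConnected_J.inter ordConnected_Ioi).isPreconnected
  have hRJ : S.J ∩ Ioi p ⊆ S.J := inter_subset_left
  have hRμ : volume.restrict (S.J ∩ Ioi p) ≤ S.μ := Measure.restrict_mono hRJ le_rfl
  have hfR := hf.mono hRJ (A' := A) fun _ _ => rfl
  have hgR := (hg.mono hRJ (hAA _ fun h => lt_irrefl p h.2)).star
  have hRend : ∀ w ∈ (S.J ∩ Ioi p) \ S.M, wronskian f (fun y => star (g y)) w = 0 := by
    intro w hw
    refine hfR.wronskian_eq_zero hA hgR hRo hRJ hRc (hf2.mono_measure hRμ) (hgs2.mono_measure hRμ)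
      ?_ hw
    rcases hright with hlp | ⟨b₀, hb⟩
    · obtain ⟨u, hu, hu2⟩ := hlp E
      exact Or.inr ⟨u, hu.isSolutionOn.mono hRJ fun _ _ => rfl, fun h => hu2 ⟨p, hp, h⟩⟩
    · refine Or.inl ⟨𝓝[<] b₀, ψb, inferInstance, ?_, hfd.right b₀ hb, (hgd.right b₀ hb).star⟩
      have hbp : p < b₀ := by have := hp.2; rw [hb.eq] at this; exact_mod_cast this
      filter_upwards [hb.mem, mem_nhdsWithin_of_mem_nhds (Ioi_mem_nhds hbp)] with x h1 h2
      exact ⟨⟨h1.1, h2⟩, h1.2⟩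
  have hRmem : ∀ᶠ w in 𝓝[>] p, w ∈ (S.J ∩ Ioi p) \ S.M := by
    filter_upwards [nhdsWithin_mono p (fun y hy => ne_of_gt hy) (S.diff_mem_punctured hp),
      self_mem_nhdsWithin] with w h1 h2
    exact ⟨⟨h1.1, h2⟩, h1.2⟩
  have h3 : r 0 * star (r' 1) - r 1 * star (r' 0) = 0 :=
    tendsto_nhds_unique_of_eventuallyEq
      (tendsto_wronskian hr0 hr1 hr0'.star (hstar hr1')) tendsto_const_nhds
      (hRmem.mono fun w hw => hRend w hw)
  have hrs : star r' = ((A' n₀).map (fun t : ℝ => (t : ℂ))).mulVec (star l') := by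
    rw [hlr', Matrix.star_mulVec_map_ofReal]
  refine sin_sub_eq_zero_of_parallel (Λ n₀) (Θ n₀) (Θ' n₀) (hR n₀).ne' hl hl' h1 h2 ?_
  rw [← hrs, ← hlr]
  exact h3

end SturmData

/-! ### The set of exceptional angles is null -/

theorem mainTheorem4 (S : SturmData) (ψa ψb : ℝ) (Λ R : S.idx → ℝ) (hR : ∀ n, 0 < R n)
    (hleft : ∀ Θ : S.idx → ℝ, S.LimitPointLeft Λ R Θ ∨ S.RegularLeft)
    (hright : ∀ Θ : S.idx → ℝ, S.LimitPointRight Λ R Θ ∨ S.RegularRight)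
    (q : S.idx → Measure ℝ) [∀ n, IsProbabilityMeasure (q n)]
    (hq : ∃ n₀, ∀ t : ℝ, q n₀ {t} = 0) (E : ℝ)
    (B : Set (S.idx → ℝ)) (hB : NullMeasurableSet B (Measure.infinitePi q))
    (hBE : B ⊆ {Θ | (E : ℂ) ∈ pointSpectrum (S.hamiltonian ψa ψb Λ R Θ)}) :
    Measure.infinitePi q B = 0 := by
  classical
  obtain ⟨n₀, hn₀⟩ := hq
  have : NullSingletonClass (q n₀) := ⟨hn₀⟩
  refine Measure.infinitePi_null_of_update_null q n₀ hB fun Θ => ?_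
  -- Once the section contains a point `s`, all its points differ from `s` by a multiple of `π`, so
  -- it is countable and null for the atomless `q n₀`.
  rcases eq_empty_or_nonempty {t | Function.update Θ n₀ t ∈ B} with h | ⟨s, hs⟩
  · rw [h, measure_empty]
  · refine ((countable_sin_sub_eq_zero s).mono fun t ht => ?_).measure_zero _
    have := SturmData.sin_sub_eq_zero_of_mem_pointSpectrum hR (hleft _) (hright _)
      (Θ := Function.update Θ n₀ s) (Θ' := Function.update Θ n₀ t) (n₀ := n₀)
      (fun n hn => by rw [Function.update_of_ne hn, Function.update_of_ne hn]) (hBE hs) (hBE ht)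
    simpa using this
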